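/- Let $N\in\mathbb N$ and, for each agent $i\in\{1,\dots,N\}$, let $\Xi_i\subseteq\mathbb R^{p_i}$ and let $\mathbb P_i$ be a probability distribution on $\Xi_i$ with $\mathbb E_{\mathbb P_i}[\|\xi_i\|]<\infty$ and, for some $a_i>1$, $\mathbb E_{\mathbb P_i}[\exp(\|\xi_i\|^{a_i})]<\infty$. Let $b_i,c_i>0$, and for $K_i\ge 1$ and $\beta_i\in(0,1)$ let $$\epsilon_i(K_i,\beta_i)=\begin{cases}\Big(\dfrac{\ln(c_i/\beta_i)}{b_iK_i}\Big)^{1/\max\{p_i,2\}} & \text{if } K_i\ge \dfrac{\ln(c_i/\beta_i)}{b_i},\\[2mm] \Big(\dfrac{\ln(c_i/\beta_i)}{b_iK_i}\Big)^{1/a_i} & \text{otherwise}\end{cases}$$ (the value when $\beta_i>c_i$ is irrelevant below). For distributions $\mathbb Q_1,\mathbb Q_2$ on $\Xi_i$ with finite first moment let $d_W(\mathbb Q_1,\mathbb Q_2)=\inf_\Pi\int\|\xi_1-\xi_2\|\,\Pi(d\xi_1,d\xi_2)$, the infimum being over all joint distributions $\Pi$ on $\Xi_i^2$ with marginals $\mathbb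 Q_1,\mathbb Q_2$. Let $\hat{\mathbb P}_{K_i}=\frac1{K_i}\sum_{k=1}^{K_i}\delta_{\xi_i^{(k)}}$ be the empirical distribution of the first $K_i$ samples of agent $i$, where the $\xi^{(k)}=(\xi_i^{(k)})_{i=1}^N$, $k\ge1$, are independent draws from $\mathbb P=\prod_{i=1}^N\mathbb P_i$; write $\mathbb P^\infty$ for the law of the whole sequence $(\xi^{(k)})_{k\ge1}$ and $\mathbb P_i^\infty$ for that of $(\xi_i^{(k)})_{k\ge1}$. For each $i$ let $(\beta_i^{(K_i)})_{K_i\ge1}$ be a sequence in $(0,1)$ with $\sum_{K_i=1}^\infty\beta_i^{(K_i)}<\infty$ and $\lim_{K_i\to\infty}\epsilon_i(K_i,\beta_i^{(K_i)})=0$. Let $L_{i,j}$, $1\le i\le N$, $1\le j\le n_i$, be real constants and, for $K=(K_1,\dots,K_N)$, put $$\rho_K=\sum_{i=1}^N\sum_{j=1}^{n_i}L_{i,j}^2\big[\epsilon_i(K_i,\beta_i^{(K_i)})+d_W(\hat{\mathbb P}_{K_i},\mathbb P_i)\big]^2 .$$ Then $d_W(\hat{\mathbb P}_{K_i},\mathbb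 P_i)\to0$ as $K_i\to\infty$, $\mathbb P_i^\infty$-almost surely, for every $i$; and, $\mathbb P^\infty$-almost surely, $\rho_K\to0$ as $K_i\to\infty$ jointly for all $i$. -/

import Mathlib

open MeasureTheory Filter Topology

namespace DRNash

noncomputable section

/-- The set of probability distributions on `Ξ ⊆ ℝ^p` with finite first moment. -/
def finiteFirstMoment {p : ℕ} (Ξ : Set (EuclideanSpace ℝ (Fin p))) : Set (Measure Ξ) :=
  {Q | IsProbabilityMeasure Q ∧ Integrable (fun ξ : Ξ => ‖(ξ : EuclideanSpace ℝ (Fin p))‖) Q}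

/-- The light-tail assumption with exponent `a > 1`: `Q` has finite first moment and
`𝔼_Q[exp(‖ξ‖^a)] < ∞`. -/
structure LightTail {p : ℕ} {Ξ : Set (EuclideanSpace ℝ (Fin p))} (Q : Measure Ξ) (a : ℝ) :
    Prop where
  one_lt : 1 < a
  mem : Q ∈ finiteFirstMoment Ξ
  integrable_exp :
    Integrable (fun ξ : Ξ => Real.exp (‖(ξ : EuclideanSpace ℝ (Fin p))‖ ^ a)) Q

/-- The joint distributions on `Ξ × Ξ` with marginals `Q₁` and `Q₂`. -/
def couplings {p : ℕ} {Ξ : Set (EuclideanSpace ℝ (Fin p))} (Q₁ Q₂ : Measure Ξ) :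
    Set (Measure (Ξ × Ξ)) :=
  {π | π.map Prod.fst = Q₁ ∧ π.map Prod.snd = Q₂}

/-- The Wasserstein distance
`d_W(Q₁, Q₂) = inf_π ∫ ‖ξ₁ - ξ₂‖ π(dξ₁, dξ₂)` over all couplings `π` of `Q₁` and `Q₂`.
The infimum is taken in `[0, ∞]`; it is finite for distributions with finite first moment,
the only ones for which the distance is meaningful. -/
def wassersteinDist {p : ℕ} {Ξ : Set (EuclideanSpace ℝ (Fin p))} (Q₁ Q₂ : Measure Ξ) : ℝ :=
  (⨅ π ∈ couplings Q₁ Q₂, ∫⁻ z : Ξ × Ξ,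
    ‖(z.1 : EuclideanSpace ℝ (Fin p)) - (z.2 : EuclideanSpace ℝ (Fin p))‖ₑ ∂π).toReal

/-- The empirical distribution `(1/K) ∑_{k < K} δ_{x k}` of the first `K` samples. -/
def empirical {p : ℕ} {Ξ : Set (EuclideanSpace ℝ (Fin p))} (x : ℕ → Ξ) (K : ℕ) : Measure Ξ :=
  (K : ENNReal)⁻¹ • ∑ k ∈ Finset.range K, Measure.dirac (x k)

/-- The radius `ε(K, β)` of the ambiguity set built from `K` samples in dimension `p` with
confidence parameter `β`, tail exponent `a` and constants `c`, `b`. -/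
def radius (p : ℕ) (a c b : ℝ) (K : ℕ) (β : ℝ) : ℝ :=
  if Real.log (c / β) / b ≤ (K : ℝ) then
    (Real.log (c / β) / (b * (K : ℝ))) ^ (1 / ((max p 2 : ℕ) : ℝ))
  else
    (Real.log (c / β) / (b * (K : ℝ))) ^ (1 / a)

/-- The law `ℙ^∞` of infinitely many independent draws `ω 0, ω 1, …` from `ℙ = ∏ i, P i`;
the `k`-th sample of agent `i` is `ω k i`. -/
def sampleLaw {N : ℕ} {p : Fin N → ℕ} {Ξ : ∀ i, Set (EuclideanSpace ℝ (Fin (p i)))}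
    (P : ∀ i, Measure (Ξ i)) [∀ i, IsProbabilityMeasure (P i)] : Measure (ℕ → ∀ i, Ξ i) :=
  Measure.infinitePi (fun _ : ℕ => Measure.pi P)

/-- The quantity
`ρ_K = ∑ i, ∑ j, L_{i,j}² (ε_i(K_i, β_i^{(K_i)}) + d_W(P̂_{K_i}, P_i))²`
for sample sizes `K = (K_i)` and samples `ω`. -/
def rho {N : ℕ} {p n : Fin N → ℕ} {Ξ : ∀ i, Set (EuclideanSpace ℝ (Fin (p i)))}
    (P : ∀ i, Measure (Ξ i)) (L : ∀ i, Fin (n i) → ℝ) (a c b : Fin N → ℝ)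
    (β : Fin N → ℕ → ℝ) (ω : ℕ → ∀ i, Ξ i) (K : Fin N → ℕ) : ℝ :=
  ∑ i, ∑ j, L i j ^ 2 *
    (radius (p i) (a i) (c i) (b i) (K i) (β i (K i)) +
      wassersteinDist (empirical (fun k => ω k i) (K i)) (P i)) ^ 2

end

end DRNash

/-!
The heart of the matter is that the empirical distributions `Q_K` of an i.i.d. sequence with law
`P` converge to `P` in Wasserstein distance almost surely
(`ae_tendsto_wassersteinDist_empirical`). The proof combines the strong law of large numbers with
an explicit coupling.

Fix a scale `ε` and split the support into countably many measurable cells `A j` of diameter at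
most `ε`. To couple `Q` with `P`, match as much mass as possible inside each of the first `m` cells,
namely `min (Q (A j)) (P (A j))`, at price `ε` per unit of mass, and pair what is left over
arbitrarily; since `‖x - y‖ ≤ ‖x‖ + ‖y‖`, the latter costs at most the first moments of the two
residual measures (`hasCoupling_of_cells`). The strong law applied to the indicators of the cells,
and to the norm restricted to the cells and to the complement of the first `m` of them, shows that
each of these two moments converges, as `K → ∞`, to the moment of `P` outside the first `m` cells
(`tendsto_lintegral_residual`). This is small for `m` large because `P` has a finite first moment,
so eventually the total cost is at most `3 ε` (`eventually_hasCoupling`). Taking the scales `1 / n`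
keeps the exceptional events countable in number.

The result holds for any i.i.d. sequence on any space, so it applies both to the law of the samples
of one agent and, coordinate by coordinate, to `sampleLaw P`. In the latter case `ρ_K` is, for
almost every outcome, a finite sum of terms each depending on a single `K i` and tending to `0`.
-/

namespace DRNash

/-! ### Couplings of finite measures -/

section Coupling

variable {X : Type*} [MeasurableSpace X]

/-- `μ` and `ν`, not necessarily normalised, can be coupled at total cost at most `C`. -/
def HasCoupling (c : X × X → ENNReal) (μ ν : Measure X) (C : ENNReal) : Prop :=
  ∃ π : Measure (X × X), π.map Prod.fst = μ ∧ π.map Prod.snd = ν ∧ ∫⁻ z, c z ∂π ≤ C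

lemma HasCoupling.mono {c : X × X → ENNReal} {μ ν : Measure X} {C C' : ENNReal}
    (h : HasCoupling c μ ν C) (hC : C ≤ C') : HasCoupling c μ ν C' := by
  obtain ⟨π, h₁, h₂, h₃⟩ := h
  exact ⟨π, h₁, h₂, h₃.trans hC⟩

lemma HasCoupling.zero (c : X × X → ENNReal) : HasCoupling c (0 : Measure X) 0 0 :=
  ⟨0, by simp, by simp, by simp⟩

lemma HasCoupling.add {c : X × X → ENNReal} {μ ν μ' ν' : Measure X} {C C' : ENNReal}
    (h : HasCoupling c μ ν C) (h' : HasCoupling c μ' ν' C') :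
    HasCoupling c (μ + μ') (ν + ν') (C + C') := by
  obtain ⟨π, h₁, h₂, h₃⟩ := h
  obtain ⟨π', h₁', h₂', h₃'⟩ := h'
  refine ⟨π + π', ?_, ?_, ?_⟩
  · rw [Measure.map_add _ _ measurable_fst, h₁, h₁']
  · rw [Measure.map_add _ _ measurable_snd, h₂, h₂']
  · rw [lintegral_add_measure]
    exact add_le_add h₃ h₃'

lemma HasCoupling.sum {ι : Type*} {c : X × X → ENNReal} {μ ν : ι → Measure X}
    {C : ι → ENNReal} (s : Finset ι) (h : ∀ i ∈ s, HasCoupling c (μ i) (ν i) (C i)) :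
    HasCoupling c (∑ i ∈ s, μ i) (∑ i ∈ s, ν i) (∑ i ∈ s, C i) := by
  classical
  induction s using Finset.induction_on with
  | empty => simpa using HasCoupling.zero c
  | insert i s hi ih =>
    simp only [Finset.sum_insert hi]
    exact (h i (Finset.mem_insert_self i s)).add
      (ih fun j hj => h j (Finset.mem_insert_of_mem hj))

/-- The normalised product is a coupling of two finite measures of equal mass. -/
lemma exists_coupling_of_mass_eq (μ ν : Measure X) [IsFiniteMeasure μ] [IsFiniteMeasure ν]
    (h : μ Set.univ = ν Set.univ) :
    ∃ π : Measure (X × X), π.map Prod.fst = μ ∧ π.map Prod.snd = ν := by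
  by_cases h0 : μ Set.univ = 0
  · have hμ : μ = 0 := Measure.measure_univ_eq_zero.1 h0
    have hν : ν = 0 := Measure.measure_univ_eq_zero.1 (h ▸ h0)
    exact ⟨0, by simp [hμ], by simp [hν]⟩
  · have hinv : (μ Set.univ)⁻¹ * μ Set.univ = 1 :=
      ENNReal.inv_mul_cancel h0 (measure_ne_top μ _)
    refine ⟨(μ Set.univ)⁻¹ • μ.prod ν, ?_, ?_⟩
    · rw [Measure.map_smul, Measure.map_fst_prod, smul_smul, ← h, hinv, one_smul]
    · rw [Measure.map_smul, Measure.map_snd_prod, smul_smul, hinv, one_smul]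

/-- The cost of any coupling is controlled by the moments of its marginals when
`c (x, y) ≤ h x + h y`. -/
lemma hasCoupling_of_le_add {c : X × X → ENNReal} {h : X → ENNReal} (hh : Measurable h)
    (hc : ∀ x y, c (x, y) ≤ h x + h y) (μ ν : Measure X) [IsFiniteMeasure μ]
    [IsFiniteMeasure ν] (hmass : μ Set.univ = ν Set.univ) :
    HasCoupling c μ ν (∫⁻ x, h x ∂μ + ∫⁻ x, h x ∂ν) := by
  obtain ⟨π, h₁, h₂⟩ := exists_coupling_of_mass_eq μ ν hmass
  refine ⟨π, h₁, h₂, ?_⟩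
  calc ∫⁻ z, c z ∂π ≤ ∫⁻ z, (h z.1 + h z.2) ∂π := lintegral_mono fun z => hc z.1 z.2
    _ = ∫⁻ z, h z.1 ∂π + ∫⁻ z, h z.2 ∂π := lintegral_add_left (hh.comp measurable_fst) _
    _ = ∫⁻ x, h x ∂μ + ∫⁻ x, h x ∂ν := by
      rw [← h₁, ← h₂, lintegral_map hh measurable_fst, lintegral_map hh measurable_snd]

/-- Measures living on a set on which the cost is at most `ε` are coupled at that price per
unit of mass. -/
lemma hasCoupling_of_concentrated {c : X × X → ENNReal} {A : Set X} (hA : MeasurableSet A)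
    {ε : ENNReal} (hc : ∀ x ∈ A, ∀ y ∈ A, c (x, y) ≤ ε) (μ ν : Measure X)
    [IsFiniteMeasure μ] [IsFiniteMeasure ν] (hmass : μ Set.univ = ν Set.univ)
    (hμ : μ Aᶜ = 0) (hν : ν Aᶜ = 0) :
    HasCoupling c μ ν (ε * μ Set.univ) := by
  obtain ⟨π, h₁, h₂⟩ := exists_coupling_of_mass_eq μ ν hmass
  refine ⟨π, h₁, h₂, ?_⟩
  have e₁ : ∀ᵐ z ∂π, z.1 ∈ A := by
    have : π (Prod.fst ⁻¹' Aᶜ) = 0 := by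
      rw [← Measure.map_apply measurable_fst hA.compl, h₁, hμ]
    exact this
  have e₂ : ∀ᵐ z ∂π, z.2 ∈ A := by
    have : π (Prod.snd ⁻¹' Aᶜ) = 0 := by
      rw [← Measure.map_apply measurable_snd hA.compl, h₂, hν]
    exact this
  calc ∫⁻ z, c z ∂π ≤ ∫⁻ _, ε ∂π := by
        refine lintegral_mono_ae ?_
        filter_upwards [e₁, e₂] with z hz₁ hz₂ using hc z.1 hz₁ z.2 hz₂
    _ = ε * μ Set.univ := by
      rw [lintegral_const, ← h₁, Measure.map_apply measurable_fst MeasurableSet.univ,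
        Set.preimage_univ]

end Coupling

/-! ### Matching two measures cell by cell -/

section Matching

variable {X : Type*} [MeasurableSpace X]

/-- The proportion of the `μ`-mass of the cell `A` that can be matched inside `A` with mass of
`ν`. It is `0 / 0 = 0` when `μ A = 0`, which does no harm as there is then nothing to match. -/
noncomputable def matchRatio (μ ν : Measure X) (A : Set X) : ENNReal := min (μ A) (ν A) / μ A

/-- What is left of `μ` after matching it with `ν` inside each of the cells
`A 0, …, A (m - 1)`. -/
noncomputable def residual (μ ν : Measure X) (A : ℕ → Set X) (m : ℕ) : Measure X :=
  μ.restrict (⋃ j ∈ Finset.range m, A j)ᶜ +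
    ∑ j ∈ Finset.range m, (1 - matchRatio μ ν (A j)) • μ.restrict (A j)

lemma matchRatio_le_one (μ ν : Measure X) (A : Set X) : matchRatio μ ν A ≤ 1 :=
  ENNReal.div_le_of_le_mul (by simp)

lemma matchRatio_mul (μ ν : Measure X) [IsFiniteMeasure μ] (A : Set X) :
    matchRatio μ ν A * μ A = min (μ A) (ν A) := by
  by_cases h : μ A = 0
  · simp [h]
  · exact ENNReal.div_mul_cancel h (measure_ne_top μ A)

lemma sum_matched_add_residual (μ ν : Measure X) {A : ℕ → Set X}
    (hA : ∀ j, MeasurableSet (A j)) (hd : Pairwise (Function.onFun Disjoint A)) (m : ℕ) :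
    ∑ j ∈ Finset.range m, matchRatio μ ν (A j) • μ.restrict (A j) + residual μ ν A m = μ := by
  have h₁ : ∑ j ∈ Finset.range m, μ.restrict (A j) =
      μ.restrict (⋃ j ∈ Finset.range m, A j) := by
    rw [Measure.restrict_biUnion_finset (hd.set_pairwise _) hA,
      ← Measure.sum_coe_finset]
  have h₂ : ∀ j, matchRatio μ ν (A j) • μ.restrict (A j) +
      (1 - matchRatio μ ν (A j)) • μ.restrict (A j) = μ.restrict (A j) := fun j => by
    rw [← add_smul, add_tsub_cancel_of_le (matchRatio_le_one μ ν (A j)), one_smul]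
  rw [residual, add_left_comm, ← Finset.sum_add_distrib, Finset.sum_congr rfl fun j _ => h₂ j,
    h₁, add_comm]
  exact Measure.restrict_add_restrict_compl
    (Finset.measurableSet_biUnion _ fun j _ => hA j)

lemma lintegral_residual (μ ν : Measure X) (A : ℕ → Set X) (m : ℕ) (h : X → ENNReal) :
    ∫⁻ x, h x ∂(residual μ ν A m) = ∫⁻ x in (⋃ j ∈ Finset.range m, A j)ᶜ, h x ∂μ +
      ∑ j ∈ Finset.range m, (1 - matchRatio μ ν (A j)) * ∫⁻ x in A j, h x ∂μ := by
  simp [residual, lintegral_add_measure, lintegral_finsetSum_measure, lintegral_smul_measure]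

lemma residual_le (μ ν : Measure X) {A : ℕ → Set X}
    (hA : ∀ j, MeasurableSet (A j)) (hd : Pairwise (Function.onFun Disjoint A)) (m : ℕ) :
    residual μ ν A m ≤ μ := by
  conv_rhs => rw [← sum_matched_add_residual μ ν hA hd m]
  exact le_add_of_nonneg_left (Measure.zero_le _)

/-- Two probability measures are coupled by matching as much mass as possible inside each cell
and pairing the residuals arbitrarily. -/
lemma hasCoupling_of_cells {c : X × X → ENNReal} {h : X → ENNReal} (hh : Measurable h)
    (hc : ∀ x y, c (x, y) ≤ h x + h y) (μ ν : Measure X) [IsProbabilityMeasure μ]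
    [IsProbabilityMeasure ν] {A : ℕ → Set X} (hA : ∀ j, MeasurableSet (A j))
    (hd : Pairwise (Function.onFun Disjoint A)) {ε : ENNReal}
    (hcA : ∀ j, ∀ x ∈ A j, ∀ y ∈ A j, c (x, y) ≤ ε) (m : ℕ) :
    HasCoupling c μ ν (ε +
      (∫⁻ x, h x ∂(residual μ ν A m) + ∫⁻ x, h x ∂(residual ν μ A m))) := by
  have hμ := sum_matched_add_residual μ ν hA hd m
  have hν := sum_matched_add_residual ν μ hA hd m
  have mass₁ : ∀ j, (matchRatio μ ν (A j) • μ.restrict (A j)) Set.univ =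
      min (μ (A j)) (ν (A j)) := fun j => by simp [matchRatio_mul]
  have mass₂ : ∀ j, (matchRatio ν μ (A j) • ν.restrict (A j)) Set.univ =
      min (μ (A j)) (ν (A j)) := fun j => by simp [matchRatio_mul, min_comm]
  have hsum : ∑ j ∈ Finset.range m, min (μ (A j)) (ν (A j)) ≤ 1 := by
    calc ∑ j ∈ Finset.range m, min (μ (A j)) (ν (A j)) ≤ ∑ j ∈ Finset.range m, μ (A j) :=
          Finset.sum_le_sum fun j _ => min_le_left _ _
      _ = μ (⋃ j ∈ Finset.range m, A j) :=
          (measure_biUnion_finset (hd.set_pairwise _) fun j _ => hA j).symm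
      _ ≤ 1 := prob_le_one
  have hμu := congrArg (fun κ : Measure X => κ Set.univ) hμ
  have hνu := congrArg (fun κ : Measure X => κ Set.univ) hν
  simp only [Measure.add_apply, Measure.finsetSum_apply, mass₁, mass₂, measure_univ] at hμu hνu
  have hres : residual μ ν A m Set.univ = residual ν μ A m Set.univ :=
    (ENNReal.add_right_inj (ne_top_of_le_ne_top ENNReal.one_ne_top hsum)).1
      (hμu.trans hνu.symm)
  have : IsFiniteMeasure (residual μ ν A m) :=
    isFiniteMeasure_of_le μ (residual_le μ ν hA hd m)
  have : IsFiniteMeasure (residual ν μ A m) :=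
    isFiniteMeasure_of_le ν (residual_le ν μ hA hd m)
  have hmatched : HasCoupling c
      (∑ j ∈ Finset.range m, matchRatio μ ν (A j) • μ.restrict (A j))
      (∑ j ∈ Finset.range m, matchRatio ν μ (A j) • ν.restrict (A j)) ε := by
    refine (HasCoupling.sum (Finset.range m)
      (C := fun j => ε * min (μ (A j)) (ν (A j))) fun j _ => ?_).mono ?_
    · have : IsFiniteMeasure (matchRatio μ ν (A j) • μ.restrict (A j)) :=
        ⟨by rw [mass₁]; exact min_lt_of_left_lt (measure_lt_top μ _)⟩
      have : IsFiniteMeasure (matchRatio ν μ (A j) • ν.restrict (A j)) :=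
        ⟨by rw [mass₂]; exact min_lt_of_left_lt (measure_lt_top μ _)⟩
      rw [← mass₁ j]
      refine hasCoupling_of_concentrated (hA j) (hcA j) _ _ ((mass₁ j).trans (mass₂ j).symm)
        ?_ ?_
      · simp [Measure.restrict_apply (hA j).compl]
      · simp [Measure.restrict_apply (hA j).compl]
    · rw [← Finset.mul_sum]
      exact mul_le_of_le_one_right' hsum
  have := hmatched.add (hasCoupling_of_le_add hh hc _ _ hres)
  rwa [hμ, hν] at this

end Matching

/-! ### Convergence on cells forces transport convergence -/

section Convergence

variable {X ι : Type*} [MeasurableSpace X] {l : Filter ι}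

lemma tendsto_one_sub_mul_of_tendsto {r u : ι → ENNReal} {U : ENNReal}
    (hr : Tendsto r l (𝓝 1)) (hu : Tendsto u l (𝓝 U)) (hU : U ≠ ⊤) :
    Tendsto (fun k => (1 - r k) * u k) l (𝓝 0) := by
  have h₁ : Tendsto (fun k => 1 - r k) l (𝓝 0) := by
    simpa using ENNReal.Tendsto.sub tendsto_const_nhds hr (Or.inl ENNReal.one_ne_top)
  simpa using ENNReal.Tendsto.mul h₁ (Or.inr hU) hu (Or.inr ENNReal.zero_ne_top)

lemma tendsto_matchRatio_left {Q : ι → Measure X} {P : Measure X} [IsFiniteMeasure P]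
    {A : Set X} (hQ : Tendsto (fun k => Q k A) l (𝓝 (P A))) (h0 : P A ≠ 0) :
    Tendsto (fun k => matchRatio (Q k) P A) l (𝓝 1) := by
  have := ENNReal.Tendsto.div (hQ.min (tendsto_const_nhds (x := P A))) (Or.inr h0) hQ
    (Or.inl (measure_ne_top P A))
  rwa [min_self, ENNReal.div_self h0 (measure_ne_top P A)] at this

lemma tendsto_matchRatio_right {Q : ι → Measure X} {P : Measure X} [IsFiniteMeasure P]
    {A : Set X} (hQ : Tendsto (fun k => Q k A) l (𝓝 (P A))) (h0 : P A ≠ 0) :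
    Tendsto (fun k => matchRatio P (Q k) A) l (𝓝 1) := by
  have := ENNReal.Tendsto.div ((tendsto_const_nhds (x := P A)).min hQ) (Or.inr h0)
    (tendsto_const_nhds (x := P A)) (Or.inl (measure_ne_top P A))
  rwa [min_self, ENNReal.div_self h0 (measure_ne_top P A)] at this

/-- If the masses and the `h`-moments of the cells converge, only the moment of `P` outside the
cells survives in the residuals. -/
lemma tendsto_lintegral_residual {Q : ι → Measure X} {P : Measure X} [IsFiniteMeasure P]
    {A : ℕ → Set X} {h : X → ENNReal} (hP : ∫⁻ x, h x ∂P ≠ ⊤) {m : ℕ}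
    (hQ : ∀ j, Tendsto (fun k => Q k (A j)) l (𝓝 (P (A j))))
    (hQh : ∀ j, Tendsto (fun k => ∫⁻ x in A j, h x ∂(Q k)) l (𝓝 (∫⁻ x in A j, h x ∂P)))
    (hQt : Tendsto (fun k => ∫⁻ x in (⋃ j ∈ Finset.range m, A j)ᶜ, h x ∂(Q k)) l
      (𝓝 (∫⁻ x in (⋃ j ∈ Finset.range m, A j)ᶜ, h x ∂P))) :
    Tendsto (fun k => ∫⁻ x, h x ∂(residual (Q k) P A m)) l
        (𝓝 (∫⁻ x in (⋃ j ∈ Finset.range m, A j)ᶜ, h x ∂P)) ∧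
      Tendsto (fun k => ∫⁻ x, h x ∂(residual P (Q k) A m)) l
        (𝓝 (∫⁻ x in (⋃ j ∈ Finset.range m, A j)ᶜ, h x ∂P)) := by
  have hfin : ∀ j, ∫⁻ x in A j, h x ∂P ≠ ⊤ := fun j =>
    ne_top_of_le_ne_top hP (setLIntegral_le_lintegral _ _)
  have hnull : ∀ j, P (A j) = 0 → ∫⁻ x in A j, h x ∂P = 0 := fun j =>
    setLIntegral_measure_zero _ _
  simp only [lintegral_residual]
  constructor
  · have : Tendsto (fun k => ∑ j ∈ Finset.range m,
        (1 - matchRatio (Q k) P (A j)) * ∫⁻ x in A j, h x ∂(Q k)) l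
        (𝓝 (∑ j ∈ Finset.range m, 0)) := by
      refine tendsto_finsetSum _ fun j _ => ?_
      by_cases h0 : P (A j) = 0
      · have := hQh j
        rw [hnull j h0] at this
        exact tendsto_of_tendsto_of_tendsto_of_le_of_le tendsto_const_nhds this
          (fun _ => zero_le) fun k => mul_le_of_le_one_left' tsub_le_self
      · exact tendsto_one_sub_mul_of_tendsto (tendsto_matchRatio_left (hQ j) h0) (hQh j)
          (hfin j)
    simpa using hQt.add this
  · have : Tendsto (fun k => ∑ j ∈ Finset.range m,
        (1 - matchRatio P (Q k) (A j)) * ∫⁻ x in A j, h x ∂P) l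
        (𝓝 (∑ j ∈ Finset.range m, 0)) := by
      refine tendsto_finsetSum _ fun j _ => ?_
      by_cases h0 : P (A j) = 0
      · simpa only [hnull j h0, mul_zero] using tendsto_const_nhds
      · exact tendsto_one_sub_mul_of_tendsto (tendsto_matchRatio_right (hQ j) h0)
          tendsto_const_nhds (hfin j)
    simpa using tendsto_const_nhds.add this

lemma tendsto_setLIntegral_compl_biUnion {P : Measure X} [IsFiniteMeasure P]
    {A : ℕ → Set X} (hA : ∀ j, MeasurableSet (A j)) (hcov : ⋃ j, A j = Set.univ)
    {h : X → ENNReal} (hP : ∫⁻ x, h x ∂P ≠ ⊤) :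
    Tendsto (fun m => ∫⁻ x in (⋃ j ∈ Finset.range m, A j)ᶜ, h x ∂P) atTop (𝓝 0) := by
  refine tendsto_setLIntegral_zero hP ?_
  have hinter : ⋂ m, (⋃ j ∈ Finset.range m, A j)ᶜ = ∅ := by
    refine Set.eq_empty_iff_forall_notMem.2 fun x hx => ?_
    obtain ⟨j, hj⟩ := Set.mem_iUnion.1 (hcov ▸ Set.mem_univ x)
    refine Set.mem_iInter.1 hx (j + 1) ?_
    simp only [Set.mem_iUnion]
    exact ⟨j, by simp, hj⟩
  have := tendsto_measure_iInter_atTop (μ := P)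
    (s := fun m => (⋃ j ∈ Finset.range m, A j)ᶜ)
    (fun m => (Finset.measurableSet_biUnion _ fun j _ => hA j).compl.nullMeasurableSet)
    (fun m m' hm => Set.compl_subset_compl.2
      (Set.biUnion_subset_biUnion_left fun j hj => by
        have : j < m := Finset.mem_range.1 hj
        exact Finset.mem_range.2 (this.trans_le hm)))
    ⟨0, measure_ne_top P _⟩
  rwa [hinter, measure_empty] at this

/-- Cell-wise convergence of masses and moments, for a countable partition into cells of cost at
most `ε`, eventually yields couplings of cost at most `3 ε`. -/
lemma eventually_hasCoupling {c : X × X → ENNReal} {h : X → ENNReal} (hh : Measurable h)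
    (hc : ∀ x y, c (x, y) ≤ h x + h y) {Q : ι → Measure X} {P : Measure X}
    [IsProbabilityMeasure P] (hprob : ∀ᶠ k in l, IsProbabilityMeasure (Q k))
    {A : ℕ → Set X} (hA : ∀ j, MeasurableSet (A j))
    (hd : Pairwise (Function.onFun Disjoint A)) (hcov : ⋃ j, A j = Set.univ)
    {ε : ENNReal} (hε : ε ≠ 0)
    (hcA : ∀ j, ∀ x ∈ A j, ∀ y ∈ A j, c (x, y) ≤ ε) (hP : ∫⁻ x, h x ∂P ≠ ⊤)
    (hQ : ∀ j, Tendsto (fun k => Q k (A j)) l (𝓝 (P (A j))))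
    (hQh : ∀ j, Tendsto (fun k => ∫⁻ x in A j, h x ∂(Q k)) l (𝓝 (∫⁻ x in A j, h x ∂P)))
    (hQt : ∀ m, Tendsto (fun k => ∫⁻ x in (⋃ j ∈ Finset.range m, A j)ᶜ, h x ∂(Q k)) l
      (𝓝 (∫⁻ x in (⋃ j ∈ Finset.range m, A j)ᶜ, h x ∂P))) :
    ∀ᶠ k in l, HasCoupling c (Q k) P (ε + (ε + ε)) := by
  obtain ⟨m, hm⟩ := ((tendsto_setLIntegral_compl_biUnion hA hcov hP).eventually_lt_const
    (pos_iff_ne_zero.2 hε)).exists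
  obtain ⟨h₁, h₂⟩ := tendsto_lintegral_residual hP hQ hQh (hQt m)
  filter_upwards [hprob, h₁.eventually_lt_const hm, h₂.eventually_lt_const hm] with k hk e₁ e₂
  exact (hasCoupling_of_cells hh hc (Q k) P hA hd hcA m).mono
    (add_le_add le_rfl (add_le_add e₁.le e₂.le))

end Convergence

/-! ### Small countable partitions -/

lemma exists_countable_partition_edist_le {X : Type*} [PseudoEMetricSpace X]
    [TopologicalSpace.SeparableSpace X] [Nonempty X] [MeasurableSpace X]
    [OpensMeasurableSpace X] {ε : ENNReal} (hε : ε ≠ 0) :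
    ∃ A : ℕ → Set X, (∀ j, MeasurableSet (A j)) ∧ Pairwise (Function.onFun Disjoint A) ∧
      ⋃ j, A j = Set.univ ∧ ∀ j, ∀ x ∈ A j, ∀ y ∈ A j, edist x y ≤ ε := by
  let B : ℕ → Set X := fun n => Metric.eball (TopologicalSpace.denseSeq X n) (ε / 2)
  have hε2 : 0 < ε / 2 := ENNReal.half_pos hε
  refine ⟨disjointed B, MeasurableSet.disjointed fun n => Metric.isOpen_eball.measurableSet,
    disjoint_disjointed B, ?_, fun j x hx y hy => ?_⟩
  · rw [iUnion_disjointed]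
    refine Set.eq_univ_of_forall fun x => ?_
    obtain ⟨n, hn⟩ := (TopologicalSpace.denseRange_denseSeq X).exists_mem_open
      Metric.isOpen_eball ⟨x, Metric.mem_eball_self hε2⟩
    exact Set.mem_iUnion.2 ⟨n, Metric.mem_eball_comm.1 hn⟩
  · have hx' := disjointed_subset B j hx
    have hy' := disjointed_subset B j hy
    calc edist x y ≤ edist x (TopologicalSpace.denseSeq X j) +
          edist y (TopologicalSpace.denseSeq X j) := edist_triangle_right _ _ _
      _ ≤ ε / 2 + ε / 2 := add_le_add (le_of_lt hx') (le_of_lt hy')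
      _ = ε := ENNReal.add_halves ε

/-! ### The law of large numbers for empirical distributions -/

section Empirical

variable {p : ℕ} {Ξ : Set (EuclideanSpace ℝ (Fin p))}

lemma isProbabilityMeasure_empirical (x : ℕ → Ξ) {K : ℕ} (hK : K ≠ 0) :
    IsProbabilityMeasure (empirical x K) := by
  refine ⟨?_⟩
  simp only [empirical, Measure.smul_apply, Measure.finsetSum_apply, measure_univ,
    Finset.sum_const, Finset.card_range, smul_eq_mul, nsmul_eq_mul, mul_one]
  exact ENNReal.inv_mul_cancel (Nat.cast_ne_zero.2 hK) (ENNReal.natCast_ne_top K)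

lemma lintegral_ofReal_empirical (x : ℕ → Ξ) {K : ℕ} (hK : K ≠ 0) {g : Ξ → ℝ}
    (hg : Measurable g) (hg0 : ∀ y, 0 ≤ g y) :
    ∫⁻ y, ENNReal.ofReal (g y) ∂(empirical x K) =
      ENNReal.ofReal ((∑ k ∈ Finset.range K, g (x k)) / K) := by
  rw [empirical, lintegral_smul_measure, lintegral_finsetSum_measure,
    ENNReal.ofReal_div_of_pos (Nat.cast_pos.2 (Nat.pos_of_ne_zero hK)),
    ENNReal.ofReal_sum_of_nonneg fun k _ => hg0 (x k), ENNReal.ofReal_natCast, div_eq_mul_inv,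
    mul_comm, smul_eq_mul, mul_comm]
  simp_rw [lintegral_dirac' _ hg.ennreal_ofReal]
  rw [mul_comm]

variable {Ω : Type*} [MeasurableSpace Ω] {μ : Measure Ω} {P : Measure Ξ} {X : ℕ → Ω → Ξ}

lemma ae_tendsto_lintegral_empirical
    (hX : ∀ k, MeasurePreserving (X k) μ P)
    (hind : ProbabilityTheory.iIndepFun X μ) {g : Ξ → ℝ} (hg : Measurable g)
    (hg0 : ∀ y, 0 ≤ g y) (hgi : Integrable g P) :
    ∀ᵐ ω ∂μ, Tendsto
      (fun K => ∫⁻ y, ENNReal.ofReal (g y) ∂(empirical (fun k => X k ω) K)) atTop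
      (𝓝 (∫⁻ y, ENNReal.ofReal (g y) ∂P)) := by
  have hid : ∀ k, ProbabilityTheory.IdentDistrib (X k) (X 0) μ μ := fun k =>
    ⟨(hX k).aemeasurable, (hX 0).aemeasurable, (hX k).map_eq.trans (hX 0).map_eq.symm⟩
  have hslln := ProbabilityTheory.strong_law_ae_real (μ := μ) (fun k => g ∘ X k)
    ((hX 0).integrable_comp_of_integrable hgi)
    (fun i j hij => (hind.indepFun hij).comp hg hg) (fun k => (hid k).comp hg)
  have hint : ∫ ω, (g ∘ X 0) ω ∂μ = ∫ y, g y ∂P := by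
    rw [← (hX 0).map_eq]
    exact (integral_map (hX 0).aemeasurable hg.aestronglyMeasurable).symm
  rw [hint] at hslln
  filter_upwards [hslln] with ω hω
  rw [← ofReal_integral_eq_lintegral_ofReal hgi (ae_of_all _ hg0)]
  refine (ENNReal.tendsto_ofReal hω).congr' ?_
  filter_upwards [eventually_ne_atTop 0] with K hK
  exact (lintegral_ofReal_empirical _ hK hg hg0).symm

lemma ae_tendsto_empirical_apply [IsProbabilityMeasure P]
    (hX : ∀ k, MeasurePreserving (X k) μ P)
    (hind : ProbabilityTheory.iIndepFun X μ) {S : Set Ξ} (hS : MeasurableSet S) :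
    ∀ᵐ ω ∂μ, Tendsto (fun K => empirical (fun k => X k ω) K S) atTop (𝓝 (P S)) := by
  have hof : ∀ y, ENNReal.ofReal (S.indicator (fun _ => (1 : ℝ)) y) =
      S.indicator (fun _ => (1 : ENNReal)) y := fun y => by
    by_cases hy : y ∈ S <;> simp [hy]
  have := ae_tendsto_lintegral_empirical hX hind
    (g := S.indicator fun _ => (1 : ℝ)) (measurable_const.indicator hS)
    (fun y => Set.indicator_nonneg (fun _ _ => zero_le_one) y)
    ((integrable_const 1).indicator hS)
  simpa only [hof, lintegral_indicator_const hS, one_mul] using this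

lemma ae_tendsto_setLIntegral_enorm_empirical
    (hX : ∀ k, MeasurePreserving (X k) μ P) (hind : ProbabilityTheory.iIndepFun X μ)
    (hP : Integrable (fun ξ : Ξ => ‖(ξ : EuclideanSpace ℝ (Fin p))‖) P)
    {S : Set Ξ} (hS : MeasurableSet S) :
    ∀ᵐ ω ∂μ, Tendsto
      (fun K => ∫⁻ ξ in S, ‖(ξ : EuclideanSpace ℝ (Fin p))‖ₑ ∂(empirical (fun k => X k ω) K))
      atTop (𝓝 (∫⁻ ξ in S, ‖(ξ : EuclideanSpace ℝ (Fin p))‖ₑ ∂P)) := by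
  have hof : ∀ y : Ξ,
      ENNReal.ofReal (S.indicator (fun ξ : Ξ => ‖(ξ : EuclideanSpace ℝ (Fin p))‖) y) =
      S.indicator (fun ξ : Ξ => ‖(ξ : EuclideanSpace ℝ (Fin p))‖ₑ) y := fun y => by
    by_cases hy : y ∈ S <;> simp [hy]
  have := ae_tendsto_lintegral_empirical hX hind
    (g := S.indicator fun ξ : Ξ => ‖(ξ : EuclideanSpace ℝ (Fin p))‖)
    (measurable_subtype_coe.norm.indicator hS)
    (fun y => Set.indicator_nonneg (fun _ _ => norm_nonneg _) y) (hP.indicator hS)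
  simpa only [hof, lintegral_indicator hS] using this

lemma tendsto_wassersteinDist_of_hasCoupling {ι : Type*} {l : Filter ι}
    {Q : ι → Measure Ξ}
    (h : ∀ δ : ENNReal, 0 < δ → ∀ᶠ k in l,
      HasCoupling (fun z : Ξ × Ξ => ‖(z.1 : EuclideanSpace ℝ (Fin p)) - z.2‖ₑ) (Q k) P δ) :
    Tendsto (fun k => wassersteinDist (Q k) P) l (𝓝 0) := by
  rw [← ENNReal.toReal_zero]
  refine (ENNReal.tendsto_toReal ENNReal.zero_ne_top).comp
    (ENNReal.tendsto_nhds_zero.2 fun δ hδ => ?_)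
  filter_upwards [h δ hδ] with k hk
  obtain ⟨π, h₁, h₂, h₃⟩ := hk
  exact (iInf₂_le π ⟨h₁, h₂⟩).trans h₃

/-- The empirical distributions of an i.i.d. sequence whose common law has a finite first moment
converge to that law in Wasserstein distance, almost surely. -/
theorem ae_tendsto_wassersteinDist_empirical [IsProbabilityMeasure P]
    (hX : ∀ k, MeasurePreserving (X k) μ P) (hind : ProbabilityTheory.iIndepFun X μ)
    (hP : Integrable (fun ξ : Ξ => ‖(ξ : EuclideanSpace ℝ (Fin p))‖) P) :
    ∀ᵐ ω ∂μ, Tendsto (fun K => wassersteinDist (empirical (fun k => X k ω) K) P)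
      atTop (𝓝 0) := by
  have : Nonempty Ξ := P.nonempty_of_neZero
  have hinv : ∀ n : ℕ, (n : ENNReal)⁻¹ ≠ 0 := fun n =>
    ENNReal.inv_ne_zero.2 (ENNReal.natCast_ne_top n)
  choose A hA hd hcov hcell using fun n : ℕ =>
    exists_countable_partition_edist_le (X := Ξ) (hinv n)
  have hP' : ∫⁻ ξ : Ξ, ‖(ξ : EuclideanSpace ℝ (Fin p))‖ₑ ∂P ≠ ⊤ := by
    have := hP.2
    rw [HasFiniteIntegral] at this
    simpa using this.ne
  have hmass := ae_all_iff.2 fun n => ae_all_iff.2 fun j =>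
    ae_tendsto_empirical_apply hX hind (hA n j)
  have hmom := ae_all_iff.2 fun n => ae_all_iff.2 fun j =>
    ae_tendsto_setLIntegral_enorm_empirical hX hind hP (hA n j)
  have htail := ae_all_iff.2 fun n => ae_all_iff.2 fun m =>
    ae_tendsto_setLIntegral_enorm_empirical hX hind hP
      (Finset.measurableSet_biUnion (Finset.range m) fun j _ => hA n j).compl
  filter_upwards [hmass, hmom, htail] with ω h₁ h₂ h₃
  refine tendsto_wassersteinDist_of_hasCoupling fun δ hδ => ?_
  -- Matching at scale `1 / n` costs at most `3 / n`, so `1 / n < δ / 3` suffices.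
  obtain ⟨n, hn⟩ := ENNReal.exists_inv_nat_lt
    (ENNReal.div_ne_zero.2 ⟨hδ.ne', ENNReal.ofNat_ne_top (n := 3)⟩)
  have hcoup := eventually_hasCoupling
    (c := fun z : Ξ × Ξ => ‖(z.1 : EuclideanSpace ℝ (Fin p)) - z.2‖ₑ)
    (h := fun ξ : Ξ => ‖(ξ : EuclideanSpace ℝ (Fin p))‖ₑ)
    measurable_subtype_coe.enorm (fun x y => enorm_sub_le)
    ((eventually_ne_atTop 0).mono fun K hK =>
      isProbabilityMeasure_empirical (fun k => X k ω) hK)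
    (hA n) (hd n) (hcov n) (hinv n)
    (fun j x hx y hy => by
      rw [← edist_eq_enorm_sub, ← Subtype.edist_eq]
      exact hcell n j x hx y hy)
    hP' (h₁ n) (h₂ n) (h₃ n)
  refine hcoup.mono fun K hK => hK.mono ?_
  calc (n : ENNReal)⁻¹ + ((n : ENNReal)⁻¹ + (n : ENNReal)⁻¹) = 3 * (n : ENNReal)⁻¹ := by ring
    _ ≤ 3 * (δ / 3) := by gcongr
    _ = δ := ENNReal.mul_div_cancel (by simp) (by simp)

end Empirical

/-! ### The samples of each agent -/

section Samples

variable {N : ℕ} {p : Fin N → ℕ} {Ξ : ∀ i, Set (EuclideanSpace ℝ (Fin (p i)))}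
  (P : ∀ i, Measure (Ξ i)) [∀ i, IsProbabilityMeasure (P i)]

lemma measurePreserving_sample (i : Fin N) (k : ℕ) :
    MeasurePreserving (fun ω : ℕ → ∀ i, Ξ i => ω k i) (sampleLaw P) (P i) :=
  (measurePreserving_eval P i).comp
    (measurePreserving_eval_infinitePi (fun _ : ℕ => Measure.pi P) k)

lemma iIndepFun_sample (i : Fin N) :
    ProbabilityTheory.iIndepFun (fun k (ω : ℕ → ∀ i, Ξ i) => ω k i) (sampleLaw P) :=
  ProbabilityTheory.iIndepFun_infinitePi (P := fun _ : ℕ => Measure.pi P)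
    (X := fun _ x => x i) fun _ => measurable_pi_apply i

end Samples

end DRNash

theorem mainTheorem5 {N : ℕ} {p n : Fin N → ℕ}
    {Ξ : ∀ i, Set (EuclideanSpace ℝ (Fin (p i)))} (hΞ : ∀ i, MeasurableSet (Ξ i))
    (P : ∀ i, Measure (Ξ i)) [∀ i, IsProbabilityMeasure (P i)]
    (L : ∀ i, Fin (n i) → ℝ) (a c b : Fin N → ℝ)
    (hP : ∀ i, DRNash.LightTail (P i) (a i))
    (hc : ∀ i, 0 < c i) (hb : ∀ i, 0 < b i)
    (β : Fin N → ℕ → ℝ)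
    (hβ : ∀ i, ∀ K, 1 ≤ K → β i K ∈ Set.Ioo (0 : ℝ) 1)
    (hβ_sum : ∀ i, Summable (β i))
    (hε : ∀ i, Tendsto (fun K : ℕ => DRNash.radius (p i) (a i) (c i) (b i) K (β i K))
      atTop (𝓝 0)) :
    (∀ i, ∀ᵐ x ∂(Measure.infinitePi (fun _ : ℕ => P i)),
      Tendsto (fun K : ℕ => DRNash.wassersteinDist (DRNash.empirical x K) (P i))
        atTop (𝓝 0)) ∧
    (∀ᵐ ω ∂(DRNash.sampleLaw P),
      Tendsto (fun K : Fin N → ℕ => DRNash.rho P L a c b β ω K)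
        (Filter.pi fun _ => atTop) (𝓝 0)) := by
  constructor
  · intro i
    exact DRNash.ae_tendsto_wassersteinDist_empirical
      (measurePreserving_eval_infinitePi fun _ : ℕ => P i)
      (ProbabilityTheory.iIndepFun_infinitePi (P := fun _ : ℕ => P i)
        (X := fun _ x => x) fun _ => measurable_id)
      (hP i).mem.2
  · have hW := ae_all_iff.2 fun i => DRNash.ae_tendsto_wassersteinDist_empirical
      (DRNash.measurePreserving_sample P i) (DRNash.iIndepFun_sample P i) (hP i).mem.2
    filter_upwards [hW] with ω hω
    have hterm : ∀ i (j : Fin (n i)), Tendsto (fun K : Fin N → ℕ => L i j ^ 2 *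
        (DRNash.radius (p i) (a i) (c i) (b i) (K i) (β i (K i)) +
          DRNash.wassersteinDist (DRNash.empirical (fun k => ω k i) (K i)) (P i)) ^ 2)
        (Filter.pi fun _ => atTop) (𝓝 0) := fun i j => by
      have h := ((((hε i).add (hω i)).pow 2).const_mul (L i j ^ 2)).comp
        (tendsto_eval_pi (fun _ : Fin N => (atTop : Filter ℕ)) i)
      simpa [Function.comp_def] using h
    simpa [DRNash.rho] using
      tendsto_finsetSum Finset.univ fun i _ => tendsto_finsetSum Finset.univ fun j _ => hterm i j
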